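/- Let $G$ be a finite group with a projective unitary representation $\{U_g\}_{g\in G}$ on $\mathbb{C}^d$, $d\ge 1$, i.e. unitary matrices with $U_gU_h=c(g,h)\,U_{gh}$ for some phases $|c(g,h)|=1$. Call a matrix $S$ symmetric if $S=U_gSU_g^\dagger$ for all $g\in G$, let $\mathcal{P}_G$ be the set of symmetric positive semidefinite matrices, and let $\mathcal{E}(S)=\frac{1}{|G|}\sum_{g\in G}U_gSU_g^\dagger$. For positive semidefinite $R,S$ put $F(R,S)=\big(\operatorname{Tr}[(R^{1/2}SR^{1/2})^{1/2}]\big)^2$ and $B(R,S)=\big(\operatorname{Tr}R+\operatorname{Tr}S-2F(R,S)^{1/2}\big)^{1/2}$ (the Bures distance). Let $R$ be a positive definite $d\times d$ matrix with condition number $k=\lambda_{\max}(R)/\lambda_{\min}(R)$, and let $$S_0=\mathcal{E}(R^{1/2})^2,\qquad S_{n}=S_{n-1}^{-1/2}\Big(\mathcal{E}\big((S_{n-1}^{1/2}RS_{n-1}^{1/2})^{1/2}\big)\Big)^2S_{n-1}^{-1/2}\quad(n\ge 1).$$ Then the problem $\min_{S\in\mathcal{P}_G}B(R,S)^2$ has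 a unique solution $T$, all the $S_n$ are positive definite (so the iteration is well defined), the sequence $\{B(R,S_n)\}_n$ is monotonically decreasing (non-increasing), and $$B(R,S_n)^2-B(R,T)^2\le\Big(1-\frac1\xi\Big)^n\big(B(R,S_0)^2-B(R,T)^2\big)\qquad\text{for all } n\in\mathbb{N},$$ with $\xi=k^{d/2+1}$. Moreover, if all symmetric matrices commute with each other, the same inequality holds with $\xi=k^{3/2}$. -/

import Mathlib

open scoped ComplexOrder MatrixOrder

noncomputable section

namespace BuresProjection

variable {G ι : Type*} [Group G] [Fintype G] [Fintype ι] [DecidableEq ι]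

/-- A (finite-dimensional) projective unitary representation of the group `G`: unitary matrices
`U g` that multiply like `G` up to a phase. -/
structure ProjUnitaryRep (G ι : Type*) [Group G] [Fintype ι] [DecidableEq ι] where
  /-- the unitary matrices `U g` -/
  U : G → Matrix ι ι ℂ
  unitary : ∀ g, U g ∈ Matrix.unitaryGroup ι ℂ
  projective : ∀ g h, ∃ c : ℂ, ‖c‖ = 1 ∧ U g * U h = c • U (g * h)

/-- `S` is symmetric, i.e. invariant under the representation: `S = U g * S * (U g)ᴴ`. -/
def IsSymmetric (ρ : ProjUnitaryRep G ι) (S : Matrix ι ι ℂ) : Prop :=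
  ∀ g, S = ρ.U g * S * (ρ.U g).conjTranspose

/-- The set of symmetric positive semidefinite matrices. -/
def symmetricPSD (ρ : ProjUnitaryRep G ι) : Set (Matrix ι ι ℂ) :=
  {S | S.PosSemidef ∧ IsSymmetric ρ S}

/-- The group twirling `S ↦ |G|⁻¹ ∑ g, U g * S * (U g)ᴴ`. -/
def twirl (ρ : ProjUnitaryRep G ι) (S : Matrix ι ι ℂ) : Matrix ι ι ℂ :=
  (Fintype.card G : ℂ)⁻¹ • ∑ g, ρ.U g * S * (ρ.U g).conjTranspose

/-- The positive semidefinite square root of a positive semidefinite matrix. -/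
def sqrtm (S : Matrix ι ι ℂ) : Matrix ι ι ℂ := CFC.sqrt S

/-- The fidelity `(Tr (R^{1/2} S R^{1/2})^{1/2})^2` of positive semidefinite matrices. -/
def fidelity (R S : Matrix ι ι ℂ) : ℝ :=
  ((sqrtm (sqrtm R * S * sqrtm R)).trace.re) ^ 2

/-- The Bures distance of positive semidefinite matrices. -/
def bures (R S : Matrix ι ι ℂ) : ℝ :=
  √(R.trace.re + S.trace.re - 2 * √(fidelity R S))

/-- `T` is a Bures projection of `R` onto the symmetric positive semidefinite matrices: a minimizer
of the squared Bures distance to `R` among these matrices. -/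
def IsBuresProjection (ρ : ProjUnitaryRep G ι) (R T : Matrix ι ι ℂ) : Prop :=
  T ∈ symmetricPSD ρ ∧ ∀ S ∈ symmetricPSD ρ, bures R T ^ 2 ≤ bures R S ^ 2

/-- One step of the algorithm:
`K(S) = S^{-1/2} (twirl ((S^{1/2} R S^{1/2})^{1/2}))^2 S^{-1/2}`, for positive definite `S`. -/
def step (ρ : ProjUnitaryRep G ι) (R S : Matrix ι ι ℂ) : Matrix ι ι ℂ :=
  (sqrtm S)⁻¹ * twirl ρ (sqrtm (sqrtm S * R * sqrtm S)) ^ 2 * (sqrtm S)⁻¹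

/-- The iterates `S_n` of the algorithm, with initial point `S_0 = (twirl (R^{1/2}))^2`. -/
def iterate (ρ : ProjUnitaryRep G ι) (R : Matrix ι ι ℂ) : ℕ → Matrix ι ι ℂ
  | 0 => twirl ρ (sqrtm R) ^ 2
  | n + 1 => step ρ R (iterate ρ R n)

/-- The largest eigenvalue of a Hermitian matrix (of positive size). -/
def lambdaMax (R : Matrix ι ι ℂ) : ℝ := sSup (spectrum ℝ R)

/-- The smallest eigenvalue of a Hermitian matrix (of positive size). -/
def lambdaMin (R : Matrix ι ι ℂ) : ℝ := sInf (spectrum ℝ R)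

/-- The condition number of a positive definite matrix. -/
def condNumber (R : Matrix ι ι ℂ) : ℝ := lambdaMax R / lambdaMin R

end BuresProjection

end

/-! For positive definite symmetric `S`, let `L` be the positive definite solution of `L * S * L =
R` (the optimal transport map) and `D` its twirl. Along symmetric directions the gradient of the
squared Bures distance to `R` at `S` is `1 - D`, and one step of the algorithm is `S ↦ D * S * D`.
Linear convergence is then a gradient-descent argument. The step gains at least `tr (S (1 - D)²)`
(`bures_sq_step_le`), while the gap to any symmetric competitor is at most `ξ` times that quantity
(`bures_sq_sub_le`), so each step shrinks the gap by the factor `1 - 1/ξ`. The gap bound comes from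
the duality `2 * affinity R P ≤ tr (R X⁻¹) + tr (P X)` (`two_affinity_le`) at a well-chosen `X`.

With `l`, `b` the extreme eigenvalues of `R` and `m` a lower bound for the iterates, `ξ` must
dominate `b / √(l m)` and `√(b / l)`. The bound `S ≤ b` persists because the square of a twirl is
below the twirl of the square. For `m`, twirling does not decrease determinants, hence `det S_n ≥
det R`, giving `m = l^d / b^(d-1)`; in the commuting case `m = l` works.

The rate holds against every competitor, so a limit point of the iterates is a minimizer, and it is
positive definite. There `D = 1`, and the equality case of the duality gives uniqueness. -/

noncomputable section

namespace BuresProjection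

/-! ### Traces, square roots and the Loewner order. -/

section Matrices

variable {ι : Type*} [Fintype ι]

/-- The real part of the trace. -/
def retr (A : Matrix ι ι ℂ) : ℝ := A.trace.re

lemma retr_add (A B : Matrix ι ι ℂ) : retr (A + B) = retr A + retr B := by simp [retr]

lemma retr_sub (A B : Matrix ι ι ℂ) : retr (A - B) = retr A - retr B := by simp [retr]

lemma retr_smul (c : ℝ) (A : Matrix ι ι ℂ) : retr (c • A) = c * retr A := by
  simp [retr, Matrix.trace_smul]

lemma retr_mul_comm (A B : Matrix ι ι ℂ) : retr (A * B) = retr (B * A) := by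
  rw [retr, Matrix.trace_mul_comm, retr]

lemma retr_conjTranspose (A : Matrix ι ι ℂ) : retr A.conjTranspose = retr A := by
  simp [retr, Matrix.trace_conjTranspose]

lemma retr_nonneg {A : Matrix ι ι ℂ} (hA : A.PosSemidef) : 0 ≤ retr A :=
  (Complex.le_def.1 hA.trace_nonneg).1

lemma eq_zero_of_retr_eq_zero {A : Matrix ι ι ℂ} (hA : A.PosSemidef) (h : retr A = 0) : A = 0 := by
  refine hA.trace_eq_zero_iff.1 (Complex.ext h ?_)
  exact (Complex.le_def.1 hA.trace_nonneg).2.symm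

lemma conj_posSemidef {A B : Matrix ι ι ℂ} (hA : A.PosSemidef) (hB : B.IsHermitian) :
    (B * A * B).PosSemidef := by
  simpa [hB.eq] using hA.mul_mul_conjTranspose_same B

lemma conj_le_conj {A B C : Matrix ι ι ℂ} (h : A ≤ B) (hC : C.IsHermitian) :
    C * A * C ≤ C * B * C := by
  rw [Matrix.le_iff] at h ⊢
  have := conj_posSemidef h hC
  rwa [Matrix.mul_sub, Matrix.sub_mul] at this

variable [DecidableEq ι]

lemma sqrtm_posSemidef (A : Matrix ι ι ℂ) : (sqrtm A).PosSemidef :=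
  Matrix.nonneg_iff_posSemidef.1 (CFC.sqrt_nonneg A)

lemma sqrtm_mul_self {A : Matrix ι ι ℂ} (hA : A.PosSemidef) : sqrtm A * sqrtm A = A :=
  CFC.sqrt_mul_sqrt_self A hA.nonneg

lemma sqrtm_unique {A B : Matrix ι ι ℂ} (hB : B.PosSemidef) (h : B * B = A) : sqrtm A = B :=
  CFC.sqrt_unique h hB.nonneg

lemma sqrtm_posDef {A : Matrix ι ι ℂ} (hA : A.PosDef) : (sqrtm A).PosDef := by
  rw [(sqrtm_posSemidef A).posDef_iff_isUnit]
  refine IsUnit.of_mul_eq_one (sqrtm A * A⁻¹) ?_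
  rw [← Matrix.mul_assoc, sqrtm_mul_self hA.posSemidef]
  exact Matrix.mul_nonsing_inv _ ((Matrix.isUnit_iff_isUnit_det _).1 hA.isUnit)

lemma mul_inv_of_posDef {A : Matrix ι ι ℂ} (hA : A.PosDef) : A * A⁻¹ = 1 :=
  Matrix.mul_nonsing_inv _ ((Matrix.isUnit_iff_isUnit_det _).1 hA.isUnit)

lemma inv_mul_of_posDef {A : Matrix ι ι ℂ} (hA : A.PosDef) : A⁻¹ * A = 1 :=
  Matrix.nonsing_inv_mul _ ((Matrix.isUnit_iff_isUnit_det _).1 hA.isUnit)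

lemma conj_posDef {A B : Matrix ι ι ℂ} (hA : A.PosDef) (hB : B.PosDef) : (B * A * B).PosDef := by
  rw [(conj_posSemidef hA.posSemidef hB.isHermitian).posDef_iff_isUnit]
  exact (hB.isUnit.mul hA.isUnit).mul hB.isUnit

lemma retr_mul_nonneg {A B : Matrix ι ι ℂ} (hA : A.PosSemidef) (hB : B.PosSemidef) :
    0 ≤ retr (A * B) := by
  have := retr_nonneg (conj_posSemidef hB (sqrtm_posSemidef A).isHermitian)
  rwa [retr_mul_comm, ← Matrix.mul_assoc, sqrtm_mul_self hA] at this

lemma retr_mul_le_retr_mul {A B C : Matrix ι ι ℂ} (h : A ≤ B) (hC : C.PosSemidef) :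
    retr (A * C) ≤ retr (B * C) := by
  have := retr_mul_nonneg (Matrix.le_iff.1 h) hC
  rw [Matrix.sub_mul, retr_sub] at this
  linarith

omit [Fintype ι] [DecidableEq ι] in
lemma smul_posSemidef {A : Matrix ι ι ℂ} (hA : A.PosSemidef) {c : ℝ} (hc : 0 ≤ c) :
    (c • A).PosSemidef := hA.smul hc

omit [Fintype ι] in
lemma posDef_of_smul_one_le {A : Matrix ι ι ℂ} {c : ℝ} (hc : 0 < c) (h : c • 1 ≤ A) :
    A.PosDef := by
  have h1 : (c • (1 : Matrix ι ι ℂ)).PosDef := Matrix.PosDef.one.smul hc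
  have := h1.add_posSemidef (Matrix.le_iff.1 h)
  simpa using this

section

open scoped Matrix.Norms.L2Operator

/-- Operator monotonicity of the square root; no commutation is needed in this direction. -/
lemma le_of_mul_self_le {A B : Matrix ι ι ℂ} (hA : A.PosSemidef) (hB : B.PosSemidef)
    (h : A * A ≤ B * B) : A ≤ B := by
  have := CFC.sqrt_le_sqrt _ _ h
  rwa [CFC.sqrt_mul_self A hA.nonneg, CFC.sqrt_mul_self B hB.nonneg] at this

end

lemma smul_one_le_of_mul_self {A : Matrix ι ι ℂ} (hA : A.PosSemidef) {c : ℝ} (hc : 0 ≤ c)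
    (h : (c * c) • 1 ≤ A * A) : c • 1 ≤ A := by
  refine le_of_mul_self_le (smul_posSemidef Matrix.PosSemidef.one hc) hA ?_
  simpa [smul_smul] using h

/-- A product of commuting positive semidefinite matrices is positive semidefinite. -/
lemma mul_posSemidef_of_commute {A B : Matrix ι ι ℂ} (hA : A.PosSemidef) (hB : B.PosSemidef)
    (h : Commute A B) : (A * B).PosSemidef :=
  Matrix.nonneg_iff_posSemidef.1 (h.mul_nonneg hA.nonneg hB.nonneg)

lemma commute_sqrtm {A B : Matrix ι ι ℂ} (h : Commute A B) : Commute (sqrtm A) B := by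
  exact h.cfcₙ_nnreal NNReal.sqrt

end Matrices

/-! ### Eigenvalue and determinant bounds. -/

section Spectral

variable {ι : Type*} [Fintype ι] [DecidableEq ι]

lemma smul_one_le_of_eigenvalues {A : Matrix ι ι ℂ} (hA : A.IsHermitian) {c : ℝ}
    (h : ∀ i, c ≤ hA.eigenvalues i) : c • 1 ≤ A := by
  have h1 : algebraMap ℝ (Matrix ι ι ℂ) c ≤ A := by
    rw [algebraMap_le_iff_le_spectrum (a := A) (ha := hA)]
    intro x hx
    rw [hA.spectrum_real_eq_range_eigenvalues] at hx
    obtain ⟨i, rfl⟩ := hx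
    exact h i
  rwa [Algebra.algebraMap_eq_smul_one] at h1

lemma eigenvalues_le_of_le_smul_one {A : Matrix ι ι ℂ} (hA : A.IsHermitian) {c : ℝ}
    (h : A ≤ c • 1) (i : ι) : hA.eigenvalues i ≤ c := by
  rw [← Algebra.algebraMap_eq_smul_one, le_algebraMap_iff_spectrum_le (a := A) (ha := hA)] at h
  exact h _ (hA.eigenvalues_mem_spectrum_real i)

lemma le_smul_one_of_eigenvalues {A : Matrix ι ι ℂ} (hA : A.IsHermitian) {c : ℝ}
    (h : ∀ i, hA.eigenvalues i ≤ c) : A ≤ c • 1 := by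
  rw [← Algebra.algebraMap_eq_smul_one, le_algebraMap_iff_spectrum_le (a := A) (ha := hA)]
  intro x hx
  rw [hA.spectrum_real_eq_range_eigenvalues] at hx
  obtain ⟨i, rfl⟩ := hx
  exact h i

lemma lambdaMin_le_eigenvalues {A : Matrix ι ι ℂ} (hA : A.IsHermitian) (i : ι) :
    lambdaMin A ≤ hA.eigenvalues i :=
  csInf_le A.finite_real_spectrum.bddBelow (hA.eigenvalues_mem_spectrum_real i)

lemma lambdaMin_smul_one_le {A : Matrix ι ι ℂ} (hA : A.IsHermitian) : lambdaMin A • 1 ≤ A :=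
  smul_one_le_of_eigenvalues hA (lambdaMin_le_eigenvalues hA)

lemma eigenvalues_le_lambdaMax {A : Matrix ι ι ℂ} (hA : A.IsHermitian) (i : ι) :
    hA.eigenvalues i ≤ lambdaMax A :=
  le_csSup A.finite_real_spectrum.bddAbove (hA.eigenvalues_mem_spectrum_real i)

lemma le_lambdaMax_smul_one {A : Matrix ι ι ℂ} (hA : A.IsHermitian) : A ≤ lambdaMax A • 1 :=
  le_smul_one_of_eigenvalues hA (eigenvalues_le_lambdaMax hA)

lemma lambdaMin_pos [Nonempty ι] {A : Matrix ι ι ℂ} (hA : A.PosDef) : 0 < lambdaMin A := by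
  have hne : (spectrum ℝ A).Nonempty :=
    ⟨_, hA.isHermitian.eigenvalues_mem_spectrum_real (Classical.arbitrary ι)⟩
  have := hne.csInf_mem A.finite_real_spectrum
  rw [hA.isHermitian.spectrum_real_eq_range_eigenvalues] at this
  obtain ⟨i, hi⟩ := this
  rw [lambdaMin, hA.isHermitian.spectrum_real_eq_range_eigenvalues, ← hi]
  exact hA.eigenvalues_pos i

lemma lambdaMin_le_lambdaMax [Nonempty ι] {A : Matrix ι ι ℂ} (hA : A.IsHermitian) :
    lambdaMin A ≤ lambdaMax A :=
  (lambdaMin_le_eigenvalues hA (Classical.arbitrary ι)).trans (eigenvalues_le_lambdaMax hA _)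

lemma det_re_eq_prod_eigenvalues {A : Matrix ι ι ℂ} (hA : A.IsHermitian) :
    A.det.re = ∏ i, hA.eigenvalues i := by
  have h := hA.det_eq_prod_eigenvalues
  have h2 : (∏ i, (hA.eigenvalues i : ℂ)) = ((∏ i, hA.eigenvalues i : ℝ) : ℂ) := by push_cast; rfl
  rw [h]
  exact (congrArg Complex.re h2).trans (Complex.ofReal_re _)

lemma det_eq_det_re {A : Matrix ι ι ℂ} (hA : A.IsHermitian) : A.det = (A.det.re : ℂ) := by
  have h := hA.det_eq_prod_eigenvalues
  rw [det_re_eq_prod_eigenvalues hA, h]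
  push_cast
  rfl

lemma lambdaMin_pow_le_det [Nonempty ι] {A : Matrix ι ι ℂ} (hA : A.PosDef) :
    lambdaMin A ^ Fintype.card ι ≤ A.det.re := by
  rw [det_re_eq_prod_eigenvalues hA.isHermitian]
  calc lambdaMin A ^ Fintype.card ι = ∏ _i : ι, lambdaMin A := by simp
    _ ≤ _ := Finset.prod_le_prod (fun _ _ => (lambdaMin_pos hA).le)
      (fun i _ => lambdaMin_le_eigenvalues hA.isHermitian i)

/-- A lower bound on the determinant and an upper bound on the eigenvalues of a positive
semidefinite matrix bound its eigenvalues from below. -/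
lemma smul_one_le_of_le_det {A : Matrix ι ι ℂ} (hA : A.PosSemidef) {b D : ℝ} (hb : 0 < b)
    (hle : A ≤ b • 1) (hdet : D ≤ A.det.re) :
    (D / b ^ (Fintype.card ι - 1)) • 1 ≤ A := by
  refine smul_one_le_of_eigenvalues hA.isHermitian fun i => ?_
  rw [div_le_iff₀ (by positivity)]
  rw [det_re_eq_prod_eigenvalues hA.isHermitian, ← Finset.mul_prod_erase _ _ (Finset.mem_univ i)]
    at hdet
  -- The other `d - 1` eigenvalues are each at most `b`.
  refine hdet.trans (mul_le_mul_of_nonneg_left ?_ (hA.eigenvalues_nonneg i))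
  calc _ ≤ ∏ _j ∈ Finset.univ.erase i, b := Finset.prod_le_prod
        (fun j _ => hA.eigenvalues_nonneg j)
        (fun j _ => eigenvalues_le_of_le_smul_one hA.isHermitian hle j)
    _ = _ := by simp [Finset.card_erase_of_mem]

lemma retr_eq_sum_eigenvalues {A : Matrix ι ι ℂ} (hA : A.IsHermitian) :
    retr A = ∑ i, hA.eigenvalues i := by
  rw [retr, hA.trace_eq_sum_eigenvalues]
  simp

/-- Multiply `x ≤ exp (x - 1)` over the eigenvalues. -/
lemma det_le_exp_of_posSemidef {A : Matrix ι ι ℂ} (hA : A.PosSemidef) :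
    A.det.re ≤ Real.exp (retr A - Fintype.card ι) := by
  rw [det_re_eq_prod_eigenvalues hA.isHermitian, retr_eq_sum_eigenvalues hA.isHermitian]
  calc _ ≤ ∏ i, Real.exp (hA.isHermitian.eigenvalues i - 1) :=
        Finset.prod_le_prod (fun j _ => hA.eigenvalues_nonneg j)
          (fun j _ => by linarith [Real.add_one_le_exp (hA.isHermitian.eigenvalues j - 1)])
    _ = _ := by rw [← Real.exp_sum]; simp

/-- The tangent-plane inequality for `log det`, in a special case. -/
lemma det_re_le_det_re {A B : Matrix ι ι ℂ} (hA : A.PosSemidef) (hB : B.PosDef)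
    (h : retr (B⁻¹ * A) = Fintype.card ι) : A.det.re ≤ B.det.re := by
  have hs := (sqrtm_posDef hB.inv)
  have hss := sqrtm_mul_self hB.inv.posSemidef
  -- The normalised matrix `B^{-1/2} A B^{-1/2}` has trace `d`, so the exponential bound on its
  -- determinant is `1`.
  have hC := conj_posSemidef hA hs.isHermitian
  have h1 := det_le_exp_of_posSemidef hC
  have h2 : retr (sqrtm B⁻¹ * A * sqrtm B⁻¹) = Fintype.card ι := by
    rw [retr_mul_comm, ← Matrix.mul_assoc, hss, h]
  have h3 : (sqrtm B⁻¹ * A * sqrtm B⁻¹).det = (B.det)⁻¹ * A.det := by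
    rw [Matrix.det_mul_right_comm, hss, Matrix.det_mul, Matrix.det_nonsing_inv, Ring.inverse_eq_inv']
  rw [h2, sub_self, Real.exp_zero, h3, det_eq_det_re hB.isHermitian, ← Complex.ofReal_inv,
    Complex.re_ofReal_mul] at h1
  have hpos : 0 < B.det.re := (Complex.lt_def.1 hB.det_pos).1
  rwa [inv_mul_le_iff₀ hpos, mul_one] at h1

end Spectral

/-! ### Duality for the affinity, and transport maps. -/

section Affinity

variable {ι : Type*} [Fintype ι] [DecidableEq ι]

lemma mul_inv_cancel_left_of_posDef {A : Matrix ι ι ℂ} (hA : A.PosDef) (B : Matrix ι ι ℂ) :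
    A * (A⁻¹ * B) = B := by
  rw [← Matrix.mul_assoc, mul_inv_of_posDef hA, Matrix.one_mul]

lemma inv_mul_cancel_left_of_posDef {A : Matrix ι ι ℂ} (hA : A.PosDef) (B : Matrix ι ι ℂ) :
    A⁻¹ * (A * B) = B := by
  rw [← Matrix.mul_assoc, inv_mul_of_posDef hA, Matrix.one_mul]

lemma eq_zero_of_conj_eq_zero {A W : Matrix ι ι ℂ} (hA : A.IsHermitian) (hW : W.PosDef)
    (h : A * W * A = 0) : A = 0 := by
  have hs := sqrtm_posDef hW
  have h1 : (sqrtm W * A).conjTranspose * (sqrtm W * A) = 0 := by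
    rw [Matrix.conjTranspose_mul, hA.eq, hs.isHermitian.eq, ← h]
    conv_rhs => rw [← sqrtm_mul_self hW.posSemidef]
    simp only [Matrix.mul_assoc]
  have h2 := Matrix.conjTranspose_mul_self_eq_zero.1 h1
  rw [← inv_mul_cancel_left_of_posDef hs A, h2, Matrix.mul_zero]

/-- The square root of the fidelity of positive semidefinite matrices. -/
def affinity (R S : Matrix ι ι ℂ) : ℝ := retr (sqrtm (sqrtm R * S * sqrtm R))

lemma sqrt_fidelity (R S : Matrix ι ι ℂ) : √(fidelity R S) = affinity R S :=
  Real.sqrt_sq (retr_nonneg (sqrtm_posSemidef _))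

section

variable {R S X : Matrix ι ι ℂ}

lemma retr_sqrtm_conj_inv (hR : R.PosDef) :
    retr (sqrtm R * X⁻¹ * sqrtm R) = retr (R * X⁻¹) := by
  rw [retr_mul_comm, ← Matrix.mul_assoc, sqrtm_mul_self hR.posSemidef]

/-- The defect in the variational inequality for the affinity. -/
lemma affinity_defect (hR : R.PosDef) (hX : X.PosDef) (hS : S.PosSemidef) :
    ∃ A W : Matrix ι ι ℂ, A.IsHermitian ∧ W.PosDef ∧
      A = sqrtm R * X⁻¹ * sqrtm R - sqrtm (sqrtm R * S * sqrtm R) ∧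
      retr (A * W * A) = retr (R * X⁻¹) + retr (S * X) - 2 * affinity R S := by
  have hr := sqrtm_posDef hR
  have hY := sqrtm_posSemidef (sqrtm R * S * sqrtm R)
  have hYY := sqrtm_mul_self (conj_posSemidef hS hr.isHermitian)
  -- The weight `W` inverts the first term of `A`, so `A * W * A` completes the square and only `Y *
  -- W * Y` needs rewriting.
  refine ⟨_, (sqrtm R)⁻¹ * X * (sqrtm R)⁻¹, ?_, conj_posDef hX hr.inv, rfl, ?_⟩
  · exact (conj_posDef hX.inv hr).isHermitian.sub hY.isHermitian
  · rw [affinity]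
    have hWi := retr_sqrtm_conj_inv (X := X) hR
    generalize sqrtm (sqrtm R * S * sqrtm R) = Y at *
    set r := sqrtm R
    have e : (r * X⁻¹ * r - Y) * (r⁻¹ * X * r⁻¹) * (r * X⁻¹ * r - Y) =
        r * X⁻¹ * r - Y - Y + Y * (r⁻¹ * X * r⁻¹) * Y := by
      simp only [Matrix.sub_mul, Matrix.mul_sub, Matrix.mul_assoc,
        mul_inv_cancel_left_of_posDef hr, inv_mul_cancel_left_of_posDef hr,
        mul_inv_cancel_left_of_posDef hX, inv_mul_cancel_left_of_posDef hX,
        mul_inv_of_posDef hr, inv_mul_of_posDef hr, Matrix.mul_one, Matrix.one_mul]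
      abel
    have e2 : retr (Y * (r⁻¹ * X * r⁻¹) * Y) = retr (S * X) := by
      rw [retr_mul_comm, ← Matrix.mul_assoc, hYY, retr_mul_comm S X]
      have : r * S * r * (r⁻¹ * X * r⁻¹) = r * (S * X * r⁻¹) := by
        simp only [Matrix.mul_assoc, mul_inv_cancel_left_of_posDef hr]
      rw [this, retr_mul_comm]
      simp only [Matrix.mul_assoc, inv_mul_of_posDef hr, Matrix.mul_one]
      rw [retr_mul_comm]
    rw [e, retr_add, retr_sub, retr_sub, e2, hWi]
    ring

lemma two_affinity_le (hR : R.PosDef) (hX : X.PosDef) (hS : S.PosSemidef) :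
    2 * affinity R S ≤ retr (R * X⁻¹) + retr (S * X) := by
  obtain ⟨A, W, hA, hW, -, h⟩ := affinity_defect hR hX hS
  have := retr_nonneg (conj_posSemidef hW.posSemidef hA)
  linarith

/-- A zero defect forces `A = 0`; squaring the resulting formula for the root and cancelling `sqrtm
R` recovers `S`. -/
lemma eq_of_two_affinity_eq (hR : R.PosDef) (hX : X.PosDef) (hS : S.PosSemidef)
    (h : 2 * affinity R S = retr (R * X⁻¹) + retr (S * X)) : S = X⁻¹ * R * X⁻¹ := by
  obtain ⟨A, W, hA, hW, hAeq, h'⟩ := affinity_defect hR hX hS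
  rw [h, sub_self] at h'
  have h0 := eq_zero_of_conj_eq_zero hA hW
    (eq_zero_of_retr_eq_zero (conj_posSemidef hW.posSemidef hA) h')
  have hr := sqrtm_posDef hR
  have hYY := sqrtm_mul_self (conj_posSemidef hS hr.isHermitian)
  rw [hAeq, sub_eq_zero] at h0
  rw [← h0] at hYY
  have h1 := congrArg (fun M => (sqrtm R)⁻¹ * M * (sqrtm R)⁻¹) hYY
  simp only [Matrix.mul_assoc, inv_mul_cancel_left_of_posDef hr, mul_inv_of_posDef hr, Matrix.mul_one] at h1
  rw [← h1, ← Matrix.mul_assoc (sqrtm R) (sqrtm R), sqrtm_mul_self hR.posSemidef]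
  simp only [Matrix.mul_assoc]

lemma retr_mul_inv_of_conj_eq (hX : X.PosDef) (h : X * S * X = R) :
    retr (R * X⁻¹) = retr (S * X) := by
  rw [← h, Matrix.mul_assoc, mul_inv_of_posDef hX, Matrix.mul_one, retr_mul_comm]

lemma inv_conj_eq_of_conj_eq (hX : X.PosDef) (h : X * S * X = R) : X⁻¹ * R * X⁻¹ = S := by
  rw [← h]
  simp only [Matrix.mul_assoc, inv_mul_cancel_left_of_posDef hX, mul_inv_of_posDef hX,
    Matrix.mul_one]

/-- Since `X⁻¹ * R * X⁻¹ = S`, the matrix `sqrtm R * X⁻¹ * sqrtm R` is the root defining the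
affinity. -/
lemma affinity_eq (hR : R.PosDef) (hX : X.PosDef) (h : X * S * X = R) :
    affinity R S = retr (S * X) := by
  have hr := sqrtm_posDef hR
  have h1 : sqrtm (sqrtm R * S * sqrtm R) = sqrtm R * X⁻¹ * sqrtm R := by
    refine sqrtm_unique (conj_posDef hX.inv hr).posSemidef ?_
    have : sqrtm R * X⁻¹ * sqrtm R * (sqrtm R * X⁻¹ * sqrtm R) =
      sqrtm R * X⁻¹ * (sqrtm R * sqrtm R) * X⁻¹ * sqrtm R := by simp only [Matrix.mul_assoc]
    rw [this, sqrtm_mul_self hR.posSemidef, ← h]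
    simp only [Matrix.mul_assoc, inv_mul_cancel_left_of_posDef hX,
      mul_inv_cancel_left_of_posDef hX]
  rw [affinity, h1, retr_sqrtm_conj_inv hR, retr_mul_inv_of_conj_eq hX h]

lemma bures_sq (hR : R.PosDef) (hS : S.PosSemidef) :
    bures R S ^ 2 = retr R + retr S - 2 * affinity R S := by
  have h := two_affinity_le hR Matrix.PosDef.one hS
  rw [inv_one, Matrix.mul_one, Matrix.mul_one] at h
  rw [bures, sqrt_fidelity, Real.sq_sqrt, retr, retr]
  change 0 ≤ retr R + retr S - 2 * affinity R S
  linarith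

end

/-- The optimal transport map from `S` to `R`: the positive definite solution `X` of
`X * S * X = R`. -/
def transport (R S : Matrix ι ι ℂ) : Matrix ι ι ℂ :=
  (sqrtm S)⁻¹ * sqrtm (sqrtm S * R * sqrtm S) * (sqrtm S)⁻¹

section

variable {R S : Matrix ι ι ℂ} (hR : R.PosDef) (hS : S.PosDef)
include hR hS

lemma transport_posDef : (transport R S).PosDef :=
  conj_posDef (sqrtm_posDef (conj_posDef hR (sqrtm_posDef hS))) (sqrtm_posDef hS).inv

lemma transport_conj : transport R S * S * transport R S = R := by
  have hs := sqrtm_posDef hS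
  have hss := sqrtm_mul_self hS.posSemidef
  have hYY := sqrtm_mul_self (conj_posDef hR hs).posSemidef
  rw [transport]
  generalize sqrtm (sqrtm S * R * sqrtm S) = Y at *
  generalize sqrtm S = s at *
  have : s⁻¹ * Y * s⁻¹ * S * (s⁻¹ * Y * s⁻¹) = s⁻¹ * (Y * Y) * s⁻¹ := by
    rw [← hss]
    simp only [Matrix.mul_assoc, inv_mul_cancel_left_of_posDef hs, mul_inv_cancel_left_of_posDef hs]
  rw [this, hYY]
  simp only [Matrix.mul_assoc, inv_mul_cancel_left_of_posDef hs, mul_inv_of_posDef hs,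
    Matrix.mul_one]

lemma affinity_eq_transport : affinity R S = retr (S * transport R S) :=
  affinity_eq hR (transport_posDef hR hS) (transport_conj hR hS)

/-- With `M` the transport map of `D * S * D`, expand `0 ≤ tr (S (L - D M) M⁻¹ (L - M D))`. Both
square terms equal the affinity on the right, because `L S L = R = M D S D M`. This yields the
descent estimate. -/
lemma retr_transport_le_affinity {D : Matrix ι ι ℂ} (hD : D.PosDef) :
    retr (S * transport R S * D) ≤ affinity R (D * S * D) := by
  have hS' := conj_posDef hS hD
  have hM := transport_posDef hR hS'
  have hL := transport_posDef hR hS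
  have hMc := transport_conj hR hS'
  have hLc := transport_conj hR hS
  have ha := affinity_eq_transport hR hS'
  generalize transport R S = L at *
  generalize transport R (D * S * D) = M at *
  rw [ha]
  have hpos := retr_mul_nonneg hS.posSemidef (hM.inv.posSemidef.mul_mul_conjTranspose_same (L - D * M))
  rw [Matrix.conjTranspose_sub, Matrix.conjTranspose_mul, hL.isHermitian.eq, hM.isHermitian.eq,
    hD.isHermitian.eq] at hpos
  have e : S * ((L - D * M) * M⁻¹ * (L - M * D)) =
      S * L * M⁻¹ * L - S * L * D - S * D * L + S * D * M * D := by
    simp only [Matrix.sub_mul, Matrix.mul_sub, Matrix.mul_assoc,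
        mul_inv_cancel_left_of_posDef hM, inv_mul_cancel_left_of_posDef hM]
    abel
  have e1 : retr (S * L * M⁻¹ * L) = retr (D * S * D * M) := by
    rw [retr_mul_comm, ← Matrix.mul_assoc, ← Matrix.mul_assoc, hLc, ← hMc]
    simp only [Matrix.mul_assoc, mul_inv_of_posDef hM, Matrix.mul_one]
    rw [retr_mul_comm]
    simp only [Matrix.mul_assoc]
  have e2 : retr (S * D * L) = retr (S * L * D) := by
    rw [← retr_conjTranspose]
    simp only [Matrix.conjTranspose_mul, hL.isHermitian.eq, hD.isHermitian.eq, hS.isHermitian.eq]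
    rw [← Matrix.mul_assoc, retr_mul_comm, Matrix.mul_assoc]
  have e3 : retr (S * D * M * D) = retr (D * S * D * M) := by
    rw [retr_mul_comm]
    simp only [Matrix.mul_assoc]
  rw [e, retr_add, retr_sub, retr_sub, e1, e2, e3] at hpos
  linarith

/-- From `l ≤ R = L S L ≤ b L²`, take square roots. -/
lemma smul_one_le_transport {l b : ℝ} (hl : 0 < l) (hb : 0 < b) (hlR : l • 1 ≤ R)
    (hSb : S ≤ b • 1) : √(l / b) • 1 ≤ transport R S := by
  refine smul_one_le_of_mul_self (transport_posDef hR hS).posSemidef (Real.sqrt_nonneg _) ?_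
  rw [Real.mul_self_sqrt (by positivity)]
  have h := conj_le_conj hSb (transport_posDef hR hS).isHermitian
  rw [transport_conj hR hS] at h
  have h2 := hlR.trans h
  rw [Matrix.le_iff] at h2 ⊢
  have h3 := smul_posSemidef h2 (c := b⁻¹) (by positivity)
  simp only [smul_sub, smul_smul, Matrix.mul_smul, Matrix.smul_mul, Matrix.mul_one] at h3
  rwa [inv_mul_cancel₀ hb.ne', one_smul, inv_mul_eq_div] at h3

/-- The root `Y` of `S^{1/2} R S^{1/2} ≥ l S ≥ l m` is at least `√(l m)`, and `L⁻¹ = S^{1/2} Y⁻¹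
S^{1/2}`. -/
lemma smul_inv_transport_le {l m : ℝ} (hl : 0 < l) (hm : 0 < m) (hlR : l • 1 ≤ R)
    (hmS : m • 1 ≤ S) : √(l * m) • (transport R S)⁻¹ ≤ S := by
  have hs := sqrtm_posDef hS
  have hss := sqrtm_mul_self hS.posSemidef
  have hY := sqrtm_posDef (conj_posDef hR hs)
  have hYY := sqrtm_mul_self (conj_posDef hR hs).posSemidef
  have h1 : √(l * m) • 1 ≤ sqrtm (sqrtm S * R * sqrtm S) := by
    refine smul_one_le_of_mul_self hY.posSemidef (Real.sqrt_nonneg _) ?_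
    rw [Real.mul_self_sqrt (by positivity), hYY]
    have h := conj_le_conj hlR hs.isHermitian
    simp only [Matrix.mul_smul, Matrix.smul_mul, Matrix.mul_one, hss] at h
    refine le_trans ?_ h
    have h3 := smul_posSemidef (Matrix.le_iff.1 hmS) hl.le
    rw [smul_sub, smul_smul] at h3
    exact h3
  rw [transport]
  generalize sqrtm (sqrtm S * R * sqrtm S) = Y at *
  generalize sqrtm S = s at *
  have hYi : (s⁻¹ * Y * s⁻¹)⁻¹ = s * Y⁻¹ * s := by
    refine Matrix.inv_eq_right_inv ?_
    simp only [Matrix.mul_assoc, inv_mul_cancel_left_of_posDef hs, mul_inv_cancel_left_of_posDef hY,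
      inv_mul_of_posDef hs]
  rw [hYi]
  have h2 : √(l * m) • Y⁻¹ ≤ 1 := by
    have hq := sqrtm_posDef hY
    have hqq := sqrtm_mul_self hY.posSemidef
    have h := conj_le_conj h1 hq.inv.isHermitian
    have hqi : (sqrtm Y)⁻¹ * (sqrtm Y)⁻¹ = Y⁻¹ := by rw [← Matrix.mul_inv_rev, hqq]
    simp only [Matrix.mul_smul, Matrix.smul_mul, Matrix.mul_one, hqi] at h
    generalize sqrtm Y = q at *
    rwa [← hqq, Matrix.mul_assoc, Matrix.mul_assoc, mul_inv_of_posDef hq, Matrix.mul_one,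
      inv_mul_of_posDef hq, hqq] at h
  have h := conj_le_conj h2 hs.isHermitian
  simpa only [Matrix.mul_smul, Matrix.smul_mul, Matrix.mul_one, hss] using h

end

end Affinity

/-! ### The twirl as a conditional expectation onto the symmetric matrices. -/

section Twirl

variable {G ι : Type*} [Group G] [Fintype ι] [DecidableEq ι] (ρ : ProjUnitaryRep G ι)

namespace ProjUnitaryRep

lemma conjTranspose_mul (g : G) : (ρ.U g).conjTranspose * ρ.U g = 1 :=
  (Matrix.mem_unitaryGroup_iff' (A := ρ.U g)).1 (ρ.unitary g)

lemma mul_conjTranspose (g : G) : ρ.U g * (ρ.U g).conjTranspose = 1 :=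
  (Matrix.mem_unitaryGroup_iff (A := ρ.U g)).1 (ρ.unitary g)

end ProjUnitaryRep

variable {ρ}

lemma isSymmetric_iff {S : Matrix ι ι ℂ} : IsSymmetric ρ S ↔ ∀ g, Commute S (ρ.U g) := by
  refine forall_congr' fun g => ⟨fun h => ?_, fun h => ?_⟩
  · have : S * ρ.U g = ρ.U g * S * (ρ.U g).conjTranspose * ρ.U g := by rw [← h]
    rw [Matrix.mul_assoc, ρ.conjTranspose_mul, Matrix.mul_one] at this
    exact this
  · rw [← h.eq, Matrix.mul_assoc, ρ.mul_conjTranspose, Matrix.mul_one]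

namespace IsSymmetric

variable {A B : Matrix ι ι ℂ}

lemma one : IsSymmetric ρ (1 : Matrix ι ι ℂ) :=
  isSymmetric_iff.2 fun _ => Commute.one_left _

lemma mul (hA : IsSymmetric ρ A) (hB : IsSymmetric ρ B) : IsSymmetric ρ (A * B) :=
  isSymmetric_iff.2 fun g => (isSymmetric_iff.1 hA g).mul_left (isSymmetric_iff.1 hB g)

lemma sub (hA : IsSymmetric ρ A) (hB : IsSymmetric ρ B) : IsSymmetric ρ (A - B) :=
  isSymmetric_iff.2 fun g => (isSymmetric_iff.1 hA g).sub_left (isSymmetric_iff.1 hB g)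

lemma sqrtm (hA : IsSymmetric ρ A) : IsSymmetric ρ (sqrtm A) :=
  isSymmetric_iff.2 fun g => commute_sqrtm (isSymmetric_iff.1 hA g)

lemma inv (hA : IsSymmetric ρ A) (h : A.PosDef) : IsSymmetric ρ A⁻¹ :=
  isSymmetric_iff.2 fun g => by
    have := (isSymmetric_iff.1 hA g).eq
    change A⁻¹ * ρ.U g = ρ.U g * A⁻¹
    calc A⁻¹ * ρ.U g = A⁻¹ * (ρ.U g * A) * A⁻¹ := by
          simp only [Matrix.mul_assoc, mul_inv_of_posDef h, Matrix.mul_one]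
      _ = _ := by rw [← this, inv_mul_cancel_left_of_posDef h]

end IsSymmetric

variable [Fintype G]

lemma twirl_isSymmetric (X : Matrix ι ι ℂ) : IsSymmetric ρ (twirl ρ X) := by
  intro h
  rw [twirl, Matrix.mul_smul, Matrix.smul_mul, Matrix.mul_sum, Matrix.sum_mul]
  congr 1
  rw [← Equiv.sum_comp (Equiv.mulLeft h)]
  refine Finset.sum_congr rfl fun g _ => ?_
  -- Conjugation sees the phase only through `c * star c = 1`.
  obtain ⟨c, hc, e⟩ := ρ.projective h g
  have hcc : c * star c = 1 := by
    rw [← starRingEnd_apply, Complex.mul_conj, Complex.normSq_eq_norm_sq, hc]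
    simp
  have : ρ.U h * (ρ.U g * X * (ρ.U g).conjTranspose) * (ρ.U h).conjTranspose =
      (ρ.U h * ρ.U g) * X * (ρ.U h * ρ.U g).conjTranspose := by
    simp only [Matrix.conjTranspose_mul, Matrix.mul_assoc]
  rw [this, e, Matrix.conjTranspose_smul, Matrix.mul_smul, Matrix.smul_mul, Matrix.smul_mul,
    smul_smul, mul_comm, hcc, one_smul]
  rfl

lemma twirl_sub (X Y : Matrix ι ι ℂ) : twirl ρ (X - Y) = twirl ρ X - twirl ρ Y := by
  simp only [twirl, Matrix.mul_sub, Matrix.sub_mul, Finset.sum_sub_distrib, smul_sub]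

lemma twirl_smul (c : ℝ) (X : Matrix ι ι ℂ) : twirl ρ (c • X) = c • twirl ρ X := by
  simp only [twirl, Matrix.mul_smul, Matrix.smul_mul, ← Finset.smul_sum]
  rw [smul_comm]

lemma twirl_mul_left {A : Matrix ι ι ℂ} (hA : IsSymmetric ρ A) (X : Matrix ι ι ℂ) :
    twirl ρ (A * X) = A * twirl ρ X := by
  rw [twirl, twirl, Matrix.mul_smul, Matrix.mul_sum]
  congr 1
  refine Finset.sum_congr rfl fun g _ => ?_
  rw [← Matrix.mul_assoc, ← (isSymmetric_iff.1 hA g).eq]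
  simp only [Matrix.mul_assoc]

lemma twirl_conjTranspose (X : Matrix ι ι ℂ) :
    twirl ρ X.conjTranspose = (twirl ρ X).conjTranspose := by
  simp [twirl, Matrix.conjTranspose_smul, Matrix.conjTranspose_sum, Matrix.mul_assoc]

lemma twirl_mul_right {A : Matrix ι ι ℂ} (hA : IsSymmetric ρ A) (X : Matrix ι ι ℂ) :
    twirl ρ (X * A) = twirl ρ X * A := by
  rw [twirl, twirl, Matrix.smul_mul, Matrix.sum_mul]
  congr 1
  refine Finset.sum_congr rfl fun g _ => ?_
  have : A * (ρ.U g).conjTranspose = (ρ.U g).conjTranspose * A := by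
    conv_rhs => rw [hA g]
    rw [← Matrix.mul_assoc, ← Matrix.mul_assoc, ρ.conjTranspose_mul, Matrix.one_mul]
  simp only [Matrix.mul_assoc, this]

lemma twirl_of_isSymmetric {A : Matrix ι ι ℂ} (hA : IsSymmetric ρ A) : twirl ρ A = A := by
  have : (Fintype.card G : ℂ) ≠ 0 := by simp
  rw [twirl, ← Finset.sum_congr rfl (fun g _ => hA g)]
  simp [this, ← Nat.cast_smul_eq_nsmul ℂ, smul_smul]

lemma twirl_posSemidef {X : Matrix ι ι ℂ} (hX : X.PosSemidef) : (twirl ρ X).PosSemidef := by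
  refine Matrix.PosSemidef.smul (Matrix.posSemidef_sum _ fun g _ =>
    hX.mul_mul_conjTranspose_same _) ?_
  rw [← Complex.ofReal_natCast, ← Complex.ofReal_inv]
  exact Complex.zero_le_real.2 (by positivity)

lemma twirl_mono {X Y : Matrix ι ι ℂ} (h : X ≤ Y) : twirl ρ X ≤ twirl ρ Y := by
  have := twirl_posSemidef (ρ := ρ) (Matrix.le_iff.1 h)
  rwa [twirl_sub] at this

lemma smul_one_le_twirl {X : Matrix ι ι ℂ} {c : ℝ} (h : c • 1 ≤ X) : c • 1 ≤ twirl ρ X := by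
  have := twirl_mono (ρ := ρ) h
  rwa [twirl_smul, twirl_of_isSymmetric IsSymmetric.one] at this

lemma twirl_le_smul_one {X : Matrix ι ι ℂ} {c : ℝ} (h : X ≤ c • 1) : twirl ρ X ≤ c • 1 := by
  have := twirl_mono (ρ := ρ) h
  rwa [twirl_smul, twirl_of_isSymmetric IsSymmetric.one] at this

lemma twirl_posDef [Nonempty ι] {X : Matrix ι ι ℂ} (hX : X.PosDef) : (twirl ρ X).PosDef :=
  posDef_of_smul_one_le (lambdaMin_pos hX) (smul_one_le_twirl (lambdaMin_smul_one_le hX.isHermitian))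

lemma retr_twirl (X : Matrix ι ι ℂ) : retr (twirl ρ X) = retr X := by
  have h : (Fintype.card G : ℂ) ≠ 0 := by simp
  have : (twirl ρ X).trace = X.trace := by
    rw [twirl, Matrix.trace_smul, Matrix.trace_sum]
    have : ∀ g, (ρ.U g * X * (ρ.U g).conjTranspose).trace = X.trace := fun g => by
      rw [Matrix.trace_mul_comm, ← Matrix.mul_assoc, ρ.conjTranspose_mul, Matrix.one_mul]
    simp [this, h]
  rw [retr, this, retr]

lemma retr_mul_twirl {A : Matrix ι ι ℂ} (hA : IsSymmetric ρ A) (X : Matrix ι ι ℂ) :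
    retr (A * twirl ρ X) = retr (A * X) := by
  rw [← twirl_mul_left hA, retr_twirl]

/-- Kadison's inequality: the difference is the twirl of `(Y - twirl ρ Y)²`, a variance. -/
lemma twirl_mul_self_le {Y : Matrix ι ι ℂ} (hY : Y.IsHermitian) :
    twirl ρ Y * twirl ρ Y ≤ twirl ρ (Y * Y) := by
  have hE := twirl_isSymmetric (ρ := ρ) Y
  have hEh : (twirl ρ Y).IsHermitian := by
    rw [Matrix.IsHermitian, ← twirl_conjTranspose, hY.eq]
  have h := Matrix.posSemidef_conjTranspose_mul_self (Y - twirl ρ Y)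
  rw [(hY.sub hEh).eq] at h
  have h2 := twirl_posSemidef (ρ := ρ) h
  rw [Matrix.le_iff]
  simpa only [Matrix.mul_sub, Matrix.sub_mul, twirl_sub, twirl_mul_left hE, twirl_mul_right hE,
    twirl_of_isSymmetric hE, sub_self, sub_zero] using h2

/-- Concavity of `log det`: the tangent plane at the twirl suffices, as the inverse of the twirl is
symmetric and pairs with `Y` as with the twirl itself. -/
lemma det_le_det_twirl [Nonempty ι] {Y : Matrix ι ι ℂ} (hY : Y.PosDef) :
    Y.det.re ≤ (twirl ρ Y).det.re := by
  have hE := twirl_posDef (ρ := ρ) hY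
  refine det_re_le_det_re hY.posSemidef hE ?_
  rw [← retr_mul_twirl ((twirl_isSymmetric Y).inv hE), inv_mul_of_posDef hE]
  simp [retr]

end Twirl

/-! ### One step: invariants, descent and the gap bound. -/

section Step

variable {G ι : Type*} [Group G] [Fintype G] [Fintype ι] [DecidableEq ι]
  {ρ : ProjUnitaryRep G ι} {R S : Matrix ι ι ℂ}

lemma sqrtm_mul_transport_mul_sqrtm (hS : S.PosDef) :
    sqrtm S * transport R S * sqrtm S = sqrtm (sqrtm S * R * sqrtm S) := by
  have hs := sqrtm_posDef hS
  rw [transport]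
  generalize sqrtm (sqrtm S * R * sqrtm S) = Y
  simp only [Matrix.mul_assoc, mul_inv_cancel_left_of_posDef hs, inv_mul_of_posDef hs,
    Matrix.mul_one]

lemma twirl_sqrtm_conj (hS : S.PosDef) (hSs : IsSymmetric ρ S) :
    twirl ρ (sqrtm (sqrtm S * R * sqrtm S)) =
      sqrtm S * twirl ρ (transport R S) * sqrtm S := by
  rw [← sqrtm_mul_transport_mul_sqrtm hS, twirl_mul_right hSs.sqrtm, twirl_mul_left hSs.sqrtm]

/-- Symmetric square roots of `S` pull out of the twirl and cancel, exposing the step as a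
push-forward of `S` by the averaged transport map. -/
lemma step_eq (hS : S.PosDef) (hSs : IsSymmetric ρ S) :
    step ρ R S = twirl ρ (transport R S) * S * twirl ρ (transport R S) := by
  have hs := sqrtm_posDef hS
  have hss := sqrtm_mul_self hS.posSemidef
  rw [step, twirl_sqrtm_conj hS hSs]
  generalize twirl ρ (transport R S) = D
  generalize sqrtm S = s at *
  rw [← hss, sq]
  simp only [Matrix.mul_assoc, inv_mul_cancel_left_of_posDef hs, mul_inv_of_posDef hs,
    Matrix.mul_one]

lemma step_isSymmetric (hS : S.PosDef) (hSs : IsSymmetric ρ S) : IsSymmetric ρ (step ρ R S) := by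
  rw [step_eq hS hSs]
  exact ((twirl_isSymmetric _).mul hSs).mul (twirl_isSymmetric _)

lemma step_posDef [Nonempty ι] (hR : R.PosDef) (hS : S.PosDef) (hSs : IsSymmetric ρ S) :
    (step ρ R S).PosDef := by
  rw [step_eq hS hSs]
  exact conj_posDef hS (twirl_posDef (transport_posDef hR hS))

/-- Kadison's inequality bounds the step by the twirl of `R`, once the roots of `S` are cancelled.
-/
lemma step_le_smul_one (hR : R.PosDef) (hS : S.PosDef) (hSs : IsSymmetric ρ S) {b : ℝ}
    (hb : R ≤ b • 1) : step ρ R S ≤ b • 1 := by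
  have hs := sqrtm_posDef hS
  have hY := conj_posDef hR hs
  have h := twirl_mul_self_le (ρ := ρ) (sqrtm_posSemidef (sqrtm S * R * sqrtm S)).isHermitian
  rw [sqrtm_mul_self hY.posSemidef, twirl_mul_right hSs.sqrtm, twirl_mul_left hSs.sqrtm] at h
  have h2 := conj_le_conj h hs.inv.isHermitian
  rw [← sq] at h2
  refine h2.trans (le_trans (le_of_eq ?_) (twirl_le_smul_one (ρ := ρ) hb))
  simp only [Matrix.mul_assoc, inv_mul_cancel_left_of_posDef hs, mul_inv_of_posDef hs,
    Matrix.mul_one]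

lemma det_re_conj {A B : Matrix ι ι ℂ} (hA : A.IsHermitian) (hB : B.IsHermitian) :
    (B * A * B).det.re = B.det.re * A.det.re * B.det.re := by
  rw [Matrix.det_mul, Matrix.det_mul, det_eq_det_re hA, det_eq_det_re hB]
  simp only [← Complex.ofReal_mul, Complex.ofReal_re]

lemma det_re_pos {A : Matrix ι ι ℂ} (hA : A.PosDef) : 0 < A.det.re :=
  (Complex.lt_def.1 hA.det_pos).1

/-- Compare `det R = (det L)² det S` with `(det D)² det S`. -/
lemma det_le_det_step [Nonempty ι] (hR : R.PosDef) (hS : S.PosDef) (hSs : IsSymmetric ρ S) :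
    R.det.re ≤ (step ρ R S).det.re := by
  have hL := transport_posDef hR hS
  have hD := twirl_posDef (ρ := ρ) hL
  have h := det_le_det_twirl (ρ := ρ) hL
  have h0 := det_re_pos hL
  have h1 := det_re_pos hS
  have h2 := det_re_pos hD
  rw [step_eq hS hSs, det_re_conj hS.isHermitian hD.isHermitian]
  conv_lhs => rw [← transport_conj hR hS, det_re_conj hS.isHermitian hL.isHermitian]
  gcongr

/-- One step decreases the squared Bures distance by at least the squared gradient norm. -/
lemma bures_sq_step_le [Nonempty ι] (hR : R.PosDef) (hS : S.PosDef) (hSs : IsSymmetric ρ S) :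
    retr (S * ((1 - twirl ρ (transport R S)) * (1 - twirl ρ (transport R S)))) ≤
      bures R S ^ 2 - bures R (step ρ R S) ^ 2 := by
  have hL := transport_posDef hR hS
  have hD := twirl_posDef (ρ := ρ) hL
  have hDs := twirl_isSymmetric (ρ := ρ) (transport R S)
  rw [bures_sq hR hS.posSemidef, bures_sq hR (step_posDef hR hS hSs).posSemidef,
    affinity_eq_transport hR hS, step_eq hS hSs]
  have h1 := retr_transport_le_affinity hR hS hD
  rw [← retr_mul_twirl hSs (transport R S)]
  -- Here `L` may be replaced by its twirl since `D * S` is symmetric.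
  have h2 : retr (S * transport R S * twirl ρ (transport R S)) =
      retr (S * (twirl ρ (transport R S) * twirl ρ (transport R S))) := by
    rw [retr_mul_comm, ← Matrix.mul_assoc, ← retr_mul_twirl (hDs.mul hSs), retr_mul_comm,
      ← Matrix.mul_assoc, retr_mul_comm]
  rw [h2] at h1
  generalize twirl ρ (transport R S) = D at *
  have h3 : retr (D * S * D) = retr (S * (D * D)) := by
    rw [Matrix.mul_assoc, retr_mul_comm, Matrix.mul_assoc]
  simp only [Matrix.mul_sub, Matrix.sub_mul, Matrix.mul_one, Matrix.one_mul, retr_sub]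
  linarith

/-- The Polyak-Lojasiewicz inequality for the squared Bures distance. -/
lemma bures_sq_sub_le [Nonempty ι] (hR : R.PosDef) (hS : S.PosDef) (hSs : IsSymmetric ρ S)
    {P : Matrix ι ι ℂ} (hP : P ∈ symmetricPSD ρ) {l m b ξ : ℝ} (hl : 0 < l) (hm : 0 < m)
    (hb : 0 < b) (hlR : l • 1 ≤ R) (hRb : R ≤ b • 1) (hmS : m • 1 ≤ S) (hSb : S ≤ b • 1)
    (hξ : 1 ≤ ξ) (hξ1 : 1 ≤ ξ * √(l / b)) (hξ2 : b / √(l * m) ≤ ξ) :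
    bures R S ^ 2 - bures R P ^ 2 ≤
      ξ * retr (S * ((1 - twirl ρ (transport R S)) * (1 - twirl ρ (transport R S)))) := by
  have hL := transport_posDef hR hS
  have hLc := transport_conj hR hS
  have hD := twirl_posDef (ρ := ρ) hL
  have hDs := twirl_isSymmetric (ρ := ρ) (transport R S)
  have hDt := smul_one_le_twirl (ρ := ρ) (smul_one_le_transport hR hS hl hb hlR hSb)
  have hLi := smul_inv_transport_le hR hS hl hm hlR hmS
  have hE := sqrtm_posDef hD
  have hEs := hDs.sqrtm
  have hEE := sqrtm_mul_self hD.posSemidef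
  rw [bures_sq hR hS.posSemidef, bures_sq hR hP.1, affinity_eq_transport hR hS]
  -- The dual test point is `D^{-1/2} L D^{-1/2}`: its twirl is `1`, so it pairs with every
  -- symmetric `P` to `tr P`.
  have hdual : 2 * affinity R P ≤
      retr (R * (sqrtm (twirl ρ (transport R S)) * (transport R S)⁻¹ *
        sqrtm (twirl ρ (transport R S)))) + retr P := by
    have h := two_affinity_le hR (conj_posDef hL hE.inv) hP.1
    have h1 : ((sqrtm (twirl ρ (transport R S)))⁻¹ * transport R S *
        (sqrtm (twirl ρ (transport R S)))⁻¹)⁻¹ = sqrtm (twirl ρ (transport R S)) *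
        (transport R S)⁻¹ * sqrtm (twirl ρ (transport R S)) := by
      refine Matrix.inv_eq_right_inv ?_
      simp only [Matrix.mul_assoc, inv_mul_cancel_left_of_posDef hE,
        mul_inv_cancel_left_of_posDef hL, inv_mul_of_posDef hE]
    rw [h1, ← retr_mul_twirl hP.2, twirl_mul_right (hEs.inv hE), twirl_mul_left (hEs.inv hE)] at h
    have h2 : (sqrtm (twirl ρ (transport R S)))⁻¹ * twirl ρ (transport R S) *
        (sqrtm (twirl ρ (transport R S)))⁻¹ = 1 := by
      generalize twirl ρ (transport R S) = D at *
      generalize sqrtm D = E at *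
      subst hEE
      simp only [inv_mul_cancel_left_of_posDef hE, mul_inv_of_posDef hE]
    rwa [h2, Matrix.mul_one] at h
  have hm1 : ∀ A, IsSymmetric ρ A →
      retr (A * transport R S) = retr (A * twirl ρ (transport R S)) :=
    fun A hA => (retr_mul_twirl hA _).symm
  have hvs : IsSymmetric ρ (sqrtm (twirl ρ (transport R S)) - 1) := hEs.sub IsSymmetric.one
  have ha := hm1 S hSs
  have hav := hm1 _ (hSs.mul hvs)
  have hva := hm1 _ (hvs.mul hSs)
  generalize transport R S = L at *
  clear hm1 hDs hEs hvs
  generalize twirl ρ L = D at *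
  generalize sqrtm D = E at *
  subst hEE
  have hv : (E - 1).IsHermitian := hE.isHermitian.sub Matrix.isHermitian_one
  -- Second-order expansion around `E = 1`, where `E` is the root of `D`.
  have e : R * (E * L⁻¹ * E) = L * S + (L * S) * (E - 1) + R * (E - 1) * L⁻¹ +
      R * ((E - 1) * L⁻¹ * (E - 1)) := by
    have hRL : L * S = R * L⁻¹ := by
      rw [← hLc, Matrix.mul_assoc _ L, mul_inv_of_posDef hL, Matrix.mul_one]
    rw [hRL]
    noncomm_ring
  have e1 : retr (R * (E - 1) * L⁻¹) = retr ((E - 1) * S * L) := by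
    rw [retr_mul_comm, ← Matrix.mul_assoc, ← hLc]
    simp only [Matrix.mul_assoc, inv_mul_cancel_left_of_posDef hL]
    rw [← Matrix.mul_assoc, retr_mul_comm]
  have e2 : retr (L * S * (E - 1)) = retr (S * (E - 1) * L) := by
    rw [Matrix.mul_assoc, retr_mul_comm]
  have hQ := conj_posSemidef hS.posSemidef hv
  have hcyc : ∀ M, retr ((E - 1) * S * (E - 1) * M) = retr (S * ((E - 1) * M * (E - 1))) := by
    intro M
    rw [Matrix.mul_assoc, Matrix.mul_assoc, retr_mul_comm]
    simp only [Matrix.mul_assoc]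
  -- The quadratic remainder is controlled by `R ≤ b` and `√(l m) L⁻¹ ≤ S`.
  have hb1 : √(l * m) * retr (R * ((E - 1) * L⁻¹ * (E - 1))) ≤
      b * retr ((E - 1) * S * (E - 1)) := by
    have h1 := retr_mul_le_retr_mul hRb (conj_posSemidef hL.inv.posSemidef hv)
    rw [Matrix.smul_mul, Matrix.one_mul, retr_smul] at h1
    have h2 := retr_nonneg (Matrix.le_iff.1 (conj_le_conj hLi hv))
    rw [retr_sub, Matrix.mul_smul, Matrix.smul_mul, retr_smul] at h2
    nlinarith [mul_le_mul_of_nonneg_left h1 (Real.sqrt_nonneg (l * m))]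
  have hq1 := retr_mul_nonneg hQ hE.posSemidef
  have hq2 := retr_mul_le_retr_mul hDt hQ
  rw [Matrix.smul_mul, Matrix.one_mul, retr_smul, retr_mul_comm (E * E)] at hq2
  have hq0 := retr_nonneg hQ
  have hsq : 0 < √(l * m) := Real.sqrt_pos.2 (by positivity)
  have hb2 : retr (R * ((E - 1) * L⁻¹ * (E - 1))) ≤ ξ * retr ((E - 1) * S * (E - 1)) := by
    rw [← le_div_iff₀' hsq] at hb1
    refine hb1.trans ?_
    rw [mul_div_right_comm]
    gcongr
  rw [e, retr_add, retr_add, retr_add, e1, e2, hav, hva, retr_mul_comm L S, ha] at hdual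
  rw [ha]
  rw [hcyc] at hq1 hq2
  have hc0 := hcyc 1
  rw [Matrix.mul_one, Matrix.mul_one] at hc0
  rw [hc0] at hb2 hq0 hq2
  have hva' : retr ((E - 1) * S * (E * E)) = retr (S * (E * E * (E - 1))) := by
    rw [Matrix.mul_assoc, retr_mul_comm, Matrix.mul_assoc]
  rw [hva'] at hdual
  -- With `V = E - 1`, the gap is at most `tr (S V (2E + 1 + ξ) V)` and the target is `ξ tr (S V (E²
  -- + 2E + 1) V)`. What remains follows from `ξ ≥ 1` and `ξ E² ≥ ξ √(l/b) ≥ 1`.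
  have hq3 := mul_le_mul_of_nonneg_right hξ1 hq0
  have hq4 := mul_le_mul_of_nonneg_left hq2 (zero_le_one.trans hξ)
  have hq5 := mul_nonneg (sub_nonneg.2 hξ) hq1
  clear e e1 e2 hav hva hva' ha hcyc hc0 hb1 hq1 hq2 hQ hLi hDt hξ1 hξ2
  simp only [Matrix.mul_sub, Matrix.sub_mul, Matrix.mul_one, Matrix.one_mul, Matrix.mul_assoc,
    retr_sub] at *
  linarith

end Step

/-! ### Uniform bounds on the iterates and linear convergence. -/

section Iterates

variable {G ι : Type*} [Group G] [Fintype G] [Fintype ι] [DecidableEq ι] [Nonempty ι]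
  {ρ : ProjUnitaryRep G ι} {R : Matrix ι ι ℂ}

omit [Nonempty ι] in
-- Squaring is not operator monotone in general; commutation allows the factorisation `(B - A) * (B
-- + A)`.
lemma mul_self_le_mul_self_of_commute {A B : Matrix ι ι ℂ} (hA : A.PosSemidef)
    (h : Commute A B) (hAB : A ≤ B) : A * A ≤ B * B := by
  have hsum : (B + A).PosSemidef := by
    have := (Matrix.le_iff.1 hAB).add (hA.add hA)
    rwa [← add_assoc, sub_add_cancel] at this
  have hc : Commute (B - A) (B + A) :=
    ((Commute.refl B).sub_left h).add_right (h.symm.sub_left (Commute.refl A))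
  have h2 := mul_posSemidef_of_commute (Matrix.le_iff.1 hAB) hsum hc
  rw [Matrix.le_iff]
  have e : (B - A) * (B + A) = B * B - A * A := by
    rw [Matrix.sub_mul, Matrix.mul_add, Matrix.mul_add, h.eq]
    abel
  rwa [e] at h2

omit [Nonempty ι] in
lemma smul_one_le_mul_self {A : Matrix ι ι ℂ} {c : ℝ} (hc : 0 ≤ c) (h : √c • 1 ≤ A) :
    c • 1 ≤ A * A := by
  have := mul_self_le_mul_self_of_commute
    (smul_posSemidef Matrix.PosSemidef.one (Real.sqrt_nonneg c))
    ((Commute.one_left A).smul_left _) h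
  rwa [Matrix.smul_mul, Matrix.one_mul, smul_smul, Real.mul_self_sqrt hc] at this

omit [Nonempty ι] in
lemma iterate_zero_eq : iterate ρ R 0 = twirl ρ (sqrtm R) * twirl ρ (sqrtm R) := sq _

lemma iterate_bounds (hR : R.PosDef) (n : ℕ) :
    (iterate ρ R n).PosDef ∧ IsSymmetric ρ (iterate ρ R n) ∧
      iterate ρ R n ≤ lambdaMax R • 1 ∧ R.det.re ≤ (iterate ρ R n).det.re := by
  have hb := le_lambdaMax_smul_one hR.isHermitian
  induction n with
  | zero =>
    have hr := sqrtm_posDef hR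
    have hrr := sqrtm_mul_self hR.posSemidef
    have hE := twirl_posDef (ρ := ρ) hr
    have hEs := twirl_isSymmetric (ρ := ρ) (sqrtm R)
    rw [iterate_zero_eq]
    refine ⟨?_, hEs.mul hEs, ?_, ?_⟩
    · have := conj_posDef Matrix.PosDef.one hE
      rwa [Matrix.mul_one] at this
    · have h := twirl_mul_self_le (ρ := ρ) hr.isHermitian
      rw [hrr] at h
      exact h.trans (twirl_le_smul_one hb)
    · have h1 := det_re_conj (Matrix.isHermitian_one (n := ι) (α := ℂ)) hE.isHermitian
      have h2 := det_re_conj (Matrix.isHermitian_one (n := ι) (α := ℂ)) hr.isHermitian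
      rw [Matrix.mul_one, Matrix.det_one, Complex.one_re, mul_one] at h1 h2
      rw [hrr] at h2
      rw [h1, h2]
      exact mul_self_le_mul_self (det_re_pos hr).le (det_le_det_twirl hr)
  | succ n ih =>
    obtain ⟨h1, h2, -, -⟩ := ih
    exact ⟨step_posDef hR h1 h2, step_isSymmetric h1 h2, step_le_smul_one hR h1 h2 hb,
      det_le_det_step hR h1 h2⟩

/-- If the symmetric matrices commute, the iterates stay above the smallest eigenvalue of `R`. -/
lemma lambdaMin_smul_one_le_iterate (hR : R.PosDef)
    (hcomm : ∀ A B : Matrix ι ι ℂ, IsSymmetric ρ A → IsSymmetric ρ B → A * B = B * A) (n : ℕ) :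
    lambdaMin R • 1 ≤ iterate ρ R n := by
  have hl := lambdaMin_pos hR
  have hlR := lambdaMin_smul_one_le hR.isHermitian
  cases n with
  | zero =>
    rw [iterate_zero_eq]
    refine smul_one_le_mul_self hl.le (smul_one_le_twirl ?_)
    refine smul_one_le_of_mul_self (sqrtm_posSemidef R) (Real.sqrt_nonneg _) ?_
    rwa [Real.mul_self_sqrt hl.le, sqrtm_mul_self hR.posSemidef]
  | succ n =>
    obtain ⟨hS, hSs, -, -⟩ := iterate_bounds (ρ := ρ) hR n
    rw [iterate, step]
    generalize iterate ρ R n = S at *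
    have hs := sqrtm_posDef hS
    have hss := sqrtm_mul_self hS.posSemidef
    have hsl := smul_posSemidef hs.posSemidef (Real.sqrt_nonneg (lambdaMin R))
    have hsls : (√(lambdaMin R) • sqrtm S) * (√(lambdaMin R) • sqrtm S) = lambdaMin R • S := by
      rw [Matrix.smul_mul, Matrix.mul_smul, smul_smul, Real.mul_self_sqrt hl.le, hss]
    have h1 : √(lambdaMin R) • sqrtm S ≤ sqrtm (sqrtm S * R * sqrtm S) := by
      refine le_of_mul_self_le hsl (sqrtm_posSemidef _) ?_
      rw [sqrtm_mul_self (conj_posDef hR hs).posSemidef, hsls]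
      have := conj_le_conj hlR hs.isHermitian
      rwa [Matrix.mul_smul, Matrix.mul_one, Matrix.smul_mul, hss] at this
    have h2 := twirl_mono (ρ := ρ) h1
    rw [twirl_smul, twirl_of_isSymmetric hSs.sqrtm] at h2
    -- Both sides of `h2` are symmetric, so `hcomm` makes squaring legitimate.
    have hc : Commute (√(lambdaMin R) • sqrtm S) (twirl ρ (sqrtm (sqrtm S * R * sqrtm S))) :=
      Commute.smul_left (hcomm _ _ hSs.sqrtm (twirl_isSymmetric _)) _
    have h3 := mul_self_le_mul_self_of_commute hsl hc h2
    rw [hsls, ← sq] at h3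
    have h4 := conj_le_conj h3 hs.inv.isHermitian
    refine le_trans (le_of_eq ?_) h4
    generalize sqrtm S = s at *
    rw [Matrix.mul_smul, Matrix.smul_mul, ← hss]
    simp only [inv_mul_cancel_left_of_posDef hs, mul_inv_of_posDef hs]

lemma antitone_bures_iterate (hR : R.PosDef) :
    Antitone (fun n => bures R (iterate ρ R n)) := by
  refine antitone_nat_of_succ_le fun n => ?_
  obtain ⟨hS, hSs, -, -⟩ := iterate_bounds (ρ := ρ) hR n
  have h := bures_sq_step_le hR hS hSs
  have hD := twirl_posDef (ρ := ρ) (transport_posDef hR hS)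
  have hpos := retr_mul_nonneg hS.posSemidef
    (conj_posSemidef Matrix.PosSemidef.one (Matrix.isHermitian_one.sub hD.isHermitian))
  rw [Matrix.mul_one] at hpos
  refine (pow_le_pow_iff_left₀ (Real.sqrt_nonneg _) (Real.sqrt_nonneg _) two_ne_zero).1 ?_
  change bures R (step ρ R (iterate ρ R n)) ^ 2 ≤ bures R (iterate ρ R n) ^ 2
  linarith

lemma one_le_condNumber (hR : R.PosDef) : 1 ≤ condNumber R :=
  (one_le_div (lambdaMin_pos hR)).2 (lambdaMin_le_lambdaMax hR.isHermitian)

/-- Linear convergence, given a uniform lower bound on the iterates. -/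
lemma bures_sq_iterate_sub_le (hR : R.PosDef) {m p : ℝ} (hm : 0 < m)
    (hmS : ∀ n, m • 1 ≤ iterate ρ R n) (hp : 1 / 2 ≤ p)
    (hmp : lambdaMax R / √(lambdaMin R * m) ≤ condNumber R ^ p)
    {P : Matrix ι ι ℂ} (hP : P ∈ symmetricPSD ρ) (n : ℕ) :
    bures R (iterate ρ R n) ^ 2 - bures R P ^ 2 ≤
      (1 - 1 / condNumber R ^ p) ^ n * (bures R (iterate ρ R 0) ^ 2 - bures R P ^ 2) := by
  have hl := lambdaMin_pos hR
  have hb : 0 < lambdaMax R := hl.trans_le (lambdaMin_le_lambdaMax hR.isHermitian)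
  have hk := one_le_condNumber hR
  have hξ : 1 ≤ condNumber R ^ p := Real.one_le_rpow hk (by linarith)
  have hξ1 : 1 ≤ condNumber R ^ p * √(lambdaMin R / lambdaMax R) := by
    rw [← inv_div, Real.sqrt_inv, ← div_eq_mul_inv, one_le_div (by positivity), Real.sqrt_eq_rpow]
    exact Real.rpow_le_rpow_of_exponent_le hk hp
  have hξ0 : 0 < condNumber R ^ p := zero_lt_one.trans_le hξ
  induction n with
  | zero => simp
  | succ n ih =>
    obtain ⟨hS, hSs, hSb, -⟩ := iterate_bounds (ρ := ρ) hR n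
    have h1 := bures_sq_sub_le hR hS hSs hP hl hm hb (lambdaMin_smul_one_le hR.isHermitian)
      (le_lambdaMax_smul_one hR.isHermitian) (hmS n) hSb hξ hξ1 hmp
    have h2 := mul_le_mul_of_nonneg_left (bures_sq_step_le hR hS hSs) hξ0.le
    have h3 := h1.trans h2
    change bures R (step ρ R (iterate ρ R n)) ^ 2 - _ ≤ _
    have hq : 0 ≤ 1 - 1 / condNumber R ^ p := by
      rw [sub_nonneg, div_le_one hξ0]
      exact hξ
    have h4 := mul_le_mul_of_nonneg_left ih hq
    rw [pow_succ' (1 - 1 / condNumber R ^ p), mul_assoc]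
    refine le_trans ?_ h4
    rw [← div_le_iff₀' hξ0] at h3
    have e : ∀ x : ℝ, (1 - 1 / condNumber R ^ p) * x = x - x / condNumber R ^ p := fun x => by ring
    rw [e]
    linarith

lemma smul_one_le_iterate (hR : R.PosDef) (n : ℕ) :
    (lambdaMin R ^ Fintype.card ι / lambdaMax R ^ (Fintype.card ι - 1)) • 1 ≤ iterate ρ R n := by
  obtain ⟨hS, -, hSb, hdet⟩ := iterate_bounds (ρ := ρ) hR n
  exact smul_one_le_of_le_det hS.posSemidef
    ((lambdaMin_pos hR).trans_le (lambdaMin_le_lambdaMax hR.isHermitian)) hSb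
    ((lambdaMin_pow_le_det hR).trans hdet)

lemma lambdaMax_div_sqrt_le (hR : R.PosDef) :
    lambdaMax R / √(lambdaMin R *
      (lambdaMin R ^ Fintype.card ι / lambdaMax R ^ (Fintype.card ι - 1))) ≤
      condNumber R ^ ((Fintype.card ι : ℝ) / 2 + 1) := by
  have hl := lambdaMin_pos hR
  have hb : 0 < lambdaMax R := hl.trans_le (lambdaMin_le_lambdaMax hR.isHermitian)
  have hk := one_le_condNumber hR
  have h1 : lambdaMax R / √(lambdaMin R *
      (lambdaMin R ^ Fintype.card ι / lambdaMax R ^ (Fintype.card ι - 1))) =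
      √(condNumber R ^ (Fintype.card ι + 1)) := by
    have e : ∀ x, lambdaMax R / √x = √(lambdaMax R ^ 2 / x) := fun x => by
      rw [Real.sqrt_div (sq_nonneg _), Real.sqrt_sq hb.le]
    rw [e, condNumber, div_pow]
    congr 1
    -- Nonemptiness of `ι` makes the truncated exponent `d - 1` genuine.
    obtain ⟨d, hd⟩ := Nat.exists_eq_succ_of_ne_zero (Fintype.card_ne_zero (α := ι))
    rw [hd, Nat.succ_eq_add_one, Nat.add_sub_cancel]
    field_simp
    ring
  rw [h1, Real.sqrt_eq_rpow, ← Real.rpow_natCast, ← Real.rpow_mul (by linarith)]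
  -- The quotient is exactly `k^((d+1)/2)`; the stated exponent leaves `1/2` to spare.
  refine Real.rpow_le_rpow_of_exponent_le hk ?_
  push_cast
  linarith

lemma lambdaMax_div_sqrt_self_le (hR : R.PosDef) :
    lambdaMax R / √(lambdaMin R * lambdaMin R) ≤ condNumber R ^ ((3 : ℝ) / 2) := by
  rw [Real.sqrt_mul_self (lambdaMin_pos hR).le]
  exact Real.self_le_rpow_of_one_le (one_le_condNumber hR) (by norm_num)

end Iterates

/-! ### Existence and uniqueness of the projection. -/

section Existence

open Filter Topology

variable {G ι : Type*} [Group G] [Fintype ι] [DecidableEq ι]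

open scoped Matrix.Norms.L2Operator in
lemma exists_subseq_tendsto {x : ℕ → Matrix ι ι ℂ} {m b : ℝ} (hm : 0 ≤ m) (hb : 0 ≤ b)
    (hmx : ∀ n, m • 1 ≤ x n) (hxb : ∀ n, x n ≤ b • 1) :
    ∃ (T : Matrix ι ι ℂ) (φ : ℕ → ℕ), StrictMono φ ∧ m • 1 ≤ T ∧
      ∀ f : Matrix ι ι ℂ → ℂ, Continuous f → Tendsto (fun n => f (x (φ n))) atTop (𝓝 (f T)) := by
  have hbd : ∀ n, x n ∈ Metric.closedBall (0 : Matrix ι ι ℂ) b := fun n => by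
    have h0 : 0 ≤ x n :=
      (smul_posSemidef Matrix.PosSemidef.one hm).nonneg.trans (hmx n)
    rw [mem_closedBall_zero_iff, CStarAlgebra.norm_le_iff_le_algebraMap _ hb h0,
      Algebra.algebraMap_eq_smul_one]
    exact hxb n
  obtain ⟨T, -, φ, hφ, hT⟩ := tendsto_subseq_of_bounded Metric.isBounded_closedBall hbd
  exact ⟨T, φ, hφ, ge_of_tendsto' hT fun n => hmx _, fun f hf => (hf.tendsto T).comp hT⟩

variable {ρ : ProjUnitaryRep G ι} {R : Matrix ι ι ℂ} [Fintype G] [Nonempty ι]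

lemma exists_posDef_isBuresProjection (hR : R.PosDef) :
    ∃ T, T.PosDef ∧ IsBuresProjection ρ R T := by
  have hl := lambdaMin_pos hR
  have hb : 0 < lambdaMax R := hl.trans_le (lambdaMin_le_lambdaMax hR.isHermitian)
  have hm : 0 < lambdaMin R ^ Fintype.card ι / lambdaMax R ^ (Fintype.card ι - 1) := by positivity
  obtain ⟨T, φ, hφ, hmT, hT⟩ := exists_subseq_tendsto hm.le hb.le
    (smul_one_le_iterate (ρ := ρ) hR) (fun n => (iterate_bounds hR n).2.2.1)
  have hTpos := posDef_of_smul_one_le hm hmT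
  have hTs : IsSymmetric ρ T := by
    intro g
    ext i j
    refine tendsto_nhds_unique (hT (fun S => S i j) (by fun_prop)) ?_
    refine (hT (fun S => (ρ.U g * S * (ρ.U g).conjTranspose) i j) (by fun_prop)).congr fun n => ?_
    rw [← (iterate_bounds (ρ := ρ) hR (φ n)).2.1 g]
  refine ⟨T, hTpos, ⟨hTpos.posSemidef, hTs⟩, fun P hP => ?_⟩
  have hX := transport_posDef hR hTpos
  have hXc := transport_conj hR hTpos
  have hXR : retr (R * (transport R T)⁻¹) = retr (T * transport R T) :=
    retr_mul_inv_of_conj_eq hX hXc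
  -- Freezing the dual variable at the transport map of `T` gives a lower bound for the squared
  -- distance that is affine in the iterate and sharp at `T`. This supplies lower semicontinuity
  -- without continuity of the square root.
  have hlim : Tendsto (fun n => retr R + retr (iterate ρ R (φ n)) -
      (retr (R * (transport R T)⁻¹) + retr (iterate ρ R (φ n) * transport R T)))
      atTop (𝓝 (bures R T ^ 2)) := by
    have e : bures R T ^ 2 = retr R + retr T -
        (retr (R * (transport R T)⁻¹) + retr (T * transport R T)) := by
      rw [bures_sq hR hTpos.posSemidef, affinity_eq_transport hR hTpos, hXR]
      ring
    rw [e]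
    have h1 := (Complex.continuous_re.tendsto _).comp (hT Matrix.trace (by fun_prop))
    have h2 := (Complex.continuous_re.tendsto _).comp
      (hT (fun S => (S * transport R T).trace) (by fun_prop))
    exact (h1.const_add _).sub (h2.const_add _)
  have hk : 1 ≤ condNumber R ^ ((Fintype.card ι : ℝ) / 2 + 1) :=
    Real.one_le_rpow (one_le_condNumber hR) (by positivity)
  have hlim2 : Tendsto (fun n => bures R P ^ 2 +
      (1 - 1 / condNumber R ^ ((Fintype.card ι : ℝ) / 2 + 1)) ^ φ n *
        (bures R (iterate ρ R 0) ^ 2 - bures R P ^ 2)) atTop (𝓝 (bures R P ^ 2)) := by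
    have h := (tendsto_pow_atTop_nhds_zero_of_lt_one
      (r := 1 - 1 / condNumber R ^ ((Fintype.card ι : ℝ) / 2 + 1)) ?_ ?_).comp hφ.tendsto_atTop
    · simpa using (h.mul_const _).const_add (bures R P ^ 2)
    · rw [sub_nonneg, div_le_one (by positivity)]
      exact hk
    · have : 0 < condNumber R ^ ((Fintype.card ι : ℝ) / 2 + 1) := by positivity
      linarith [div_pos one_pos this]
  refine le_of_tendsto_of_tendsto' hlim hlim2 fun n => ?_
  obtain ⟨hS, -, -, -⟩ := iterate_bounds (ρ := ρ) hR (φ n)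
  have h1 := two_affinity_le hR hX hS.posSemidef
  have h2 := bures_sq_iterate_sub_le hR hm (smul_one_le_iterate (ρ := ρ) hR)
    (by linarith [(Nat.cast_nonneg (Fintype.card ι) : (0 : ℝ) ≤ _)]) (lambdaMax_div_sqrt_le hR) hP (φ n)
  rw [bures_sq hR hS.posSemidef] at h2
  linarith

/-- A positive definite Bures projection is a fixed point of the gradient map. -/
lemma twirl_transport_eq_one {T : Matrix ι ι ℂ} (hR : R.PosDef) (hT : T.PosDef)
    (h : IsBuresProjection ρ R T) : twirl ρ (transport R T) = 1 := by
  have hD := twirl_posDef (ρ := ρ) (transport_posDef hR hT)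
  have h1 := bures_sq_step_le hR hT h.1.2
  have h2 := h.2 _ ⟨(step_posDef hR hT h.1.2).posSemidef, step_isSymmetric hT h.1.2⟩
  have hDh := Matrix.isHermitian_one.sub hD.isHermitian
  have hpsd := conj_posSemidef hT.posSemidef hDh
  rw [← Matrix.mul_assoc, retr_mul_comm, ← Matrix.mul_assoc] at h1
  -- A minimizer leaves no room for descent, so the gradient term vanishes.
  have h3 := eq_zero_of_retr_eq_zero hpsd (le_antisymm (by linarith) (retr_nonneg hpsd))
  exact (sub_eq_zero.1 (eq_zero_of_conj_eq_zero hDh hT h3)).symm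

lemma isBuresProjection_unique {T P : Matrix ι ι ℂ} (hR : R.PosDef) (hT : T.PosDef)
    (hTp : IsBuresProjection ρ R T) (hP : IsBuresProjection ρ R P) : P = T := by
  have hX := transport_posDef hR hT
  have hXc := transport_conj hR hT
  have h1 := twirl_transport_eq_one hR hT hTp
  have h2 := hP.2 T hTp.1
  rw [bures_sq hR hP.1.1, bures_sq hR hT.posSemidef, affinity_eq_transport hR hT,
    ← retr_mul_twirl hTp.1.2, h1, Matrix.mul_one] at h2
  have h3 := two_affinity_le hR hX hP.1.1
  have h4 : retr (R * (transport R T)⁻¹) = retr T := by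
    rw [retr_mul_inv_of_conj_eq hX hXc, ← retr_mul_twirl hTp.1.2, h1, Matrix.mul_one]
  have h5 : retr (P * transport R T) = retr P := by
    rw [← retr_mul_twirl hP.1.2, h1, Matrix.mul_one]
  -- Since the twirled map is `1`, optimality of `P` gives equality in the duality with the
  -- transport map of `T`.
  have h6 := eq_of_two_affinity_eq hR hX hP.1.1 (le_antisymm h3 (by linarith))
  rw [h6, inv_conj_eq_of_conj_eq hX hXc]

end Existence

end BuresProjection

end

theorem theorem1 {G ι : Type*} [Group G] [Fintype G] [Fintype ι] [DecidableEq ι] [Nonempty ι]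
    (ρ : BuresProjection.ProjUnitaryRep G ι) (R : Matrix ι ι ℂ) (hR : R.PosDef) :
    (∃! T, BuresProjection.IsBuresProjection ρ R T) ∧
    (∀ n, (BuresProjection.iterate ρ R n).PosDef) ∧
    Antitone (fun n => BuresProjection.bures R (BuresProjection.iterate ρ R n)) ∧
    ∀ T, BuresProjection.IsBuresProjection ρ R T →
      (∀ ξ : ℝ, ξ = BuresProjection.condNumber R ^ ((Fintype.card ι : ℝ) / 2 + 1) →
        ∀ n : ℕ,
          BuresProjection.bures R (BuresProjection.iterate ρ R n) ^ 2
              - BuresProjection.bures R T ^ 2 ≤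
            (1 - 1 / ξ) ^ n *
              (BuresProjection.bures R (BuresProjection.iterate ρ R 0) ^ 2
                - BuresProjection.bures R T ^ 2)) ∧
      ((∀ A B : Matrix ι ι ℂ, BuresProjection.IsSymmetric ρ A →
          BuresProjection.IsSymmetric ρ B → A * B = B * A) →
        ∀ ξ : ℝ, ξ = BuresProjection.condNumber R ^ ((3 : ℝ) / 2) →
        ∀ n : ℕ,
          BuresProjection.bures R (BuresProjection.iterate ρ R n) ^ 2
              - BuresProjection.bures R T ^ 2 ≤
            (1 - 1 / ξ) ^ n *
              (BuresProjection.bures R (BuresProjection.iterate ρ R 0) ^ 2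
                - BuresProjection.bures R T ^ 2)) := by
  obtain ⟨T, hT, hTp⟩ := BuresProjection.exists_posDef_isBuresProjection (ρ := ρ) hR
  refine ⟨⟨T, hTp, fun P hP => BuresProjection.isBuresProjection_unique hR hT hTp hP⟩,
    fun n => (BuresProjection.iterate_bounds hR n).1,
    BuresProjection.antitone_bures_iterate hR, fun P hP => ⟨?_, ?_⟩⟩
  · rintro ξ rfl n
    have hl := BuresProjection.lambdaMin_pos hR
    have hb := hl.trans_le (BuresProjection.lambdaMin_le_lambdaMax hR.isHermitian)
    exact BuresProjection.bures_sq_iterate_sub_le hR (by positivity)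
      (BuresProjection.smul_one_le_iterate hR)
      (by linarith [(Nat.cast_nonneg (Fintype.card ι) : (0 : ℝ) ≤ _)])
      (BuresProjection.lambdaMax_div_sqrt_le hR) hP.1 n
  · rintro hcomm ξ rfl n
    exact BuresProjection.bures_sq_iterate_sub_le hR (BuresProjection.lambdaMin_pos hR)
      (BuresProjection.lambdaMin_smul_one_le_iterate hR hcomm) (by norm_num)
      (BuresProjection.lambdaMax_div_sqrt_self_le hR) hP.1 n
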